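/- Let $d\in\{2,3\}$, let $\Omega\subset\mathbb R^d$ be a bounded polyhedral domain and let $\rho>0$, $C_0>0$. For $h>0$ let $\mathcal T_h$ be a conforming simplicial mesh of $\Omega$ (resolving $\partial\Omega$) with mesh size $h=\max_{T\in\mathcal T_h}\operatorname{diam}T$ that is quasi-uniform with constant $\rho$: every element contains a ball of radius $\rho h$. Let $V_h=\{u\in H^1_0(\Omega): u|_T\in P_1(T)\ \forall T\in\mathcal T_h\}$ be the space of complex-valued continuous piecewise affine functions vanishing on $\partial\Omega$, with nodal basis $(\varphi_i)_{i=1}^n$, and for $u=\sum_i x_i\varphi_i\in V_h$ write $x_u=(x_i)\in\mathbb C^n$. For $\kappa\in\mathbb R$ and $\sigma>0$ let $$a(u,v)=(\nabla u,\nabla v)-\kappa^2(u,v)+\mathrm i\sigma(u,v),$$ where $(\cdot,\cdot)$ is the $L^2(\Omega)$ inner product, and let $A_{ji}=a(\varphi_i,\varphi_j)$, $K_{ji}=(\nabla\varphi_i,\nabla\varphi_j)$, $M_{ji}=(\varphi_i,\varphi_j)$. Consider a symmetric stationary iteration for $Kx=b$, one cycle of which is $x\mapsto x+\tilde K^{-1}(b-Kx)$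 with a Hermitian (e.g. real symmetric) matrix $\tilde K^{-1}$, and let $\tilde K^{-N}$ be the matrix that maps $b$ to the result of $N$ cycles started from the zero initial guess. Let $E_N:V_h\to V_h$ be the error propagation operator, whose matrix is $(\tilde K^{-N}-K^{-1})K$, and suppose that for some $0\le\gamma_0,\gamma_1<1$ $$\|E_Nu\|_{1}\le C_0\gamma_1^N\|u\|_{1}\quad\text{and}\quad \|E_Nu\|_{0}\le C_0\gamma_0^N\|u\|_{0}\qquad\forall u\in V_h,$$ where $\|\cdot\|_0$ and $\|\cdot\|_1$ are the norms of $L^2(\Omega)$ and $H^1(\Omega)$. For $B\in\mathbb C^{n\times n}$ let $\mathcal F(B)=\{x^*Bx/x^*x : x\in\mathbb C^n,\ x\ne0\}$ be its field of values. Then there is a constant $C>0$, depending only on $d$, $\Omega$, $\rho$ and $C_0$ (hence independent of $\gamma_0,\gamma_1,\kappa,\sigma,h$, the mesh, the iteration and $N$), such that $$\operatorname{Re}\mathcal F\big(A(\tilde K^{-N}-K^{-1})M\big)\subset\big[-Ch^d(\gamma_0^N+\kappa^2\gamma_1^N),\ Ch^d(\gamma_0^N+\kappa^2\gamma_1^N)\big]$$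 and $$\operatorname{Im}\mathcal F\big(A(\tilde K^{-N}-K^{-1})M\big)\subset\big[-Ch^d(\gamma_0^N+\sigma\gamma_1^N),\ Ch^d(\gamma_0^N+\sigma\gamma_1^N)\big].$$ -/

import Mathlib

open scoped Matrix ComplexConjugate

noncomputable section

namespace Helmholtz

/-- The space `ℝ^d` with its Euclidean norm. -/
abbrev E (d : ℕ) : Type := EuclideanSpace ℝ (Fin d)

/-! ### Triangulations -/

/-- A conforming simplicial mesh of `Ω`: a finite, purely `d`-dimensional geometric simplicial
complex which fills the closure of `Ω` and resolves its boundary, that is, `∂Ω` is a union of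
`(d - 1)`-dimensional faces. -/
structure Triangulation {d : ℕ} (Ω : Set (E d)) where
  /-- the vertices, edges, ..., elements, each given by its set of corners -/
  complex : Geometry.SimplicialComplex ℝ (E d)
  finite_faces : complex.faces.Finite
  pure_dim : ∀ s ∈ complex.faces, ∃ t ∈ complex.faces, s ⊆ t ∧ t.card = d + 1
  space_eq : complex.space = closure Ω
  resolves_boundary : ∀ x ∈ frontier Ω, ∃ s ∈ complex.faces,
    s.card = d ∧ x ∈ convexHull ℝ (s : Set (E d)) ∧ convexHull ℝ (s : Set (E d)) ⊆ frontier Ω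

namespace Triangulation

variable {d : ℕ} {Ω : Set (E d)} (T : Triangulation Ω)

/-- The elements of the mesh: its `d`-dimensional simplices. -/
def elements : Set (Finset (E d)) :=
  {s | s ∈ T.complex.faces ∧ s.card = d + 1}

/-- The mesh size `h`: the largest diameter of an element. -/
def meshSize : ℝ :=
  ⨆ s : T.elements, Metric.diam (convexHull ℝ ((s : Finset (E d)) : Set (E d)))

/-- Quasi-uniformity with constant `ρ`: every element contains a ball of radius `ρ h`. A family of
meshes is quasi-uniform if all its members satisfy this with one and the same `ρ > 0`. -/
def IsQuasiUniform (ρ : ℝ) : Prop :=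
  ∀ s ∈ T.elements, ∃ c : E d,
    Metric.closedBall c (ρ * T.meshSize) ⊆ convexHull ℝ (s : Set (E d))

open Classical in
/-- The finite set of all corners of elements. -/
def allNodes : Finset (E d) := T.finite_faces.toFinset.biUnion id

open Classical in
/-- The interior nodes, which carry the degrees of freedom. -/
def nodes : Finset (E d) := T.allNodes.filter (· ∈ Ω)

/-- `w` is the family of barycentric coordinates of `x`, with respect to some simplex of the mesh
that contains `x`, extended by zero to the points that are not corners of this simplex. -/
def IsBarycentric (x : E d) (w : E d → ℝ) : Prop :=
  ∃ s ∈ T.complex.faces, (∀ y ∈ s, 0 ≤ w y) ∧ (∀ y, y ∉ s → w y = 0) ∧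
    ∑ y ∈ s, w y = 1 ∧ ∑ y ∈ s, w y • y = x

open Classical in
/-- The barycentric coordinates of `x` (zero if `x` lies in no simplex of the mesh). -/
def barycentric (x : E d) : E d → ℝ :=
  if hx : ∃ w, T.IsBarycentric x w then hx.choose else 0

/-- The nodal basis function of `v`: on every element it is the barycentric coordinate that
belongs to the corner `v` (zero if `v` is not a corner), and it vanishes off the mesh. -/
def hat (v : E d) : E d → ℂ := fun x => (T.barycentric x v : ℂ)

/-- Barycentric coordinates do not depend on the simplex in which they are computed. -/
theorem IsBarycentric.unique {T : Triangulation Ω} {x : E d} {w w' : E d → ℝ}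
    (hw : T.IsBarycentric x w) (hw' : T.IsBarycentric x w') : w = w' := by
  classical
  obtain ⟨s, hs, hw0, hws, hw1, hwx⟩ := hw
  obtain ⟨t, ht, hw0', hwt, hw1', hwx'⟩ := hw'
  have hxs : x ∈ convexHull ℝ (s : Set (E d)) := by
    rw [Finset.mem_convexHull']; exact ⟨w, hw0, hw1, hwx⟩
  have hxt : x ∈ convexHull ℝ (t : Set (E d)) := by
    rw [Finset.mem_convexHull']; exact ⟨w', hw0', hw1', hwx'⟩
  have hx := T.complex.inter_subset_convexHull hs ht ⟨hxs, hxt⟩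
  rw [← Finset.coe_inter, Finset.mem_convexHull'] at hx
  obtain ⟨u, hu0, hu1, hux⟩ := hx
  have key : ∀ (r : Finset (E d)) (_ : r ∈ T.complex.faces) (_ : s ∩ t ⊆ r) (a : E d → ℝ)
      (_ : ∀ y, y ∉ r → a y = 0) (_ : ∑ y ∈ r, a y = 1) (_ : ∑ y ∈ r, a y • y = x),
      a = fun y => if y ∈ s ∩ t then u y else 0 := by
    intro r hr hsub a har ha1 hax
    have hind := T.complex.indep hr
    have e1 : ∑ y ∈ r, (if y ∈ s ∩ t then u y else 0) = 1 := by
      rw [← hu1, Finset.sum_ite_mem, Finset.inter_eq_right.2 hsub]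
    have e2 : ∑ y ∈ r, (if y ∈ s ∩ t then u y else 0) • y = x := by
      rw [← hux]
      simp only [ite_smul, zero_smul]
      rw [Finset.sum_ite_mem, Finset.inter_eq_right.2 hsub]
    have h := (affineIndependent_iff.1 hind) Finset.univ
      (fun y => a y - if (y : E d) ∈ s ∩ t then u y else 0)
      (by
        rw [Finset.sum_sub_distrib, Finset.sum_coe_sort r a,
          Finset.sum_coe_sort r (fun y => if y ∈ s ∩ t then u y else 0), ha1, e1, sub_self])
      (by
        simp only [sub_smul]
        rw [Finset.sum_sub_distrib, Finset.sum_coe_sort r (fun y => a y • y),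
          Finset.sum_coe_sort r (fun y => (if y ∈ s ∩ t then u y else 0) • y), hax, e2, sub_self])
    funext y
    by_cases hy : y ∈ r
    · have := h ⟨y, hy⟩ (Finset.mem_univ _)
      exact sub_eq_zero.1 this
    · rw [har y hy, if_neg (fun h' => hy (hsub h'))]
  rw [key s hs Finset.inter_subset_left w hws hw1 hwx,
    key t ht Finset.inter_subset_right w' hwt hw1' hwx']

/-- The first order finite element space `V_h` with homogeneous Dirichlet condition: the continuous
functions that are affine on every element and vanish on `∂Ω` (extended by zero outside of `Ω`).
These are the continuous representatives of the elements of `H¹₀(Ω)` that are affine on every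
element. -/
def feSpace : Set (E d → ℂ) :=
  {u | Continuous u ∧
    (∀ s ∈ T.elements, ∃ g : E d →ᵃ[ℝ] ℂ, Set.EqOn u g (convexHull ℝ (s : Set (E d)))) ∧
    ∀ x, x ∉ Ω → u x = 0}

/-- The vector of coefficients of `u ∈ V_h` in the nodal basis, i.e. its values at the nodes. -/
def coeffs (u : E d → ℂ) : T.nodes → ℂ := fun v => u v

/-- The finite element function with a given vector of coefficients. -/
def ofCoeffs (c : T.nodes → ℂ) : E d → ℂ := fun x => ∑ v : T.nodes, c v * T.hat v x

end Triangulation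

/-! ### Sesquilinear forms and norms -/

section Forms

variable {d : ℕ}

/-- The `k`-th partial derivative. A function from `V_h` is Lipschitz continuous and piecewise
affine, so this exists almost everywhere and is its weak derivative. -/
def partialDeriv (k : Fin d) (u : E d → ℂ) (x : E d) : ℂ :=
  fderiv ℝ u x (EuclideanSpace.single k 1)

/-- `(u, v)`, the inner product of `L²(Ω)`. -/
def l2Inner (Ω : Set (E d)) (u v : E d → ℂ) : ℂ :=
  ∫ x in Ω, u x * conj (v x)

/-- `(∇u, ∇v)`. -/
def gradInner (Ω : Set (E d)) (u v : E d → ℂ) : ℂ :=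
  ∫ x in Ω, ∑ k, partialDeriv k u x * conj (partialDeriv k v x)

/-- The norm `‖u‖₀` of `L²(Ω)`. -/
def norm0 (Ω : Set (E d)) (u : E d → ℂ) : ℝ :=
  √(∫ x in Ω, ‖u x‖ ^ 2)

/-- The norm `‖u‖₁` of `H¹(Ω)`. -/
def norm1 (Ω : Set (E d)) (u : E d → ℂ) : ℝ :=
  √((∫ x in Ω, ‖u x‖ ^ 2) + ∫ x in Ω, ∑ k, ‖partialDeriv k u x‖ ^ 2)

/-- `a(u, v) = (∇u, ∇v) - κ² (u, v) + i σ (u, v)`. -/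
def helmholtzForm (Ω : Set (E d)) (κ σ : ℝ) (u v : E d → ℂ) : ℂ :=
  gradInner Ω u v - (κ : ℂ) ^ 2 * l2Inner Ω u v + Complex.I * σ * l2Inner Ω u v

end Forms

namespace Triangulation

variable {d : ℕ} {Ω : Set (E d)} (T : Triangulation Ω)

/-- The system matrix `A`, `A_{ji} = a(φ_i, φ_j)`. -/
def systemMatrix (κ σ : ℝ) : Matrix T.nodes T.nodes ℂ :=
  Matrix.of fun j i => helmholtzForm Ω κ σ (T.hat i) (T.hat j)

/-- The stiffness matrix `K`. -/
def stiffness : Matrix T.nodes T.nodes ℂ :=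
  Matrix.of fun j i => gradInner Ω (T.hat i) (T.hat j)

/-- The mass matrix `M`. -/
def mass : Matrix T.nodes T.nodes ℂ :=
  Matrix.of fun j i => l2Inner Ω (T.hat i) (T.hat j)

end Triangulation

/-! ### The iterative method and the field of values -/

section Iteration

variable {n : Type*} [Fintype n] [DecidableEq n]

/-- One cycle of the stationary linear iteration for `K x = b` with approximate inverse `B`. -/
def cycle (K B : Matrix n n ℂ) (b x : n → ℂ) : n → ℂ := x + B *ᵥ (b - K *ᵥ x)

/-- The matrix of the map that sends the right-hand side `b` to the result of `N` cycles started
from the zero initial guess. For one cycle this is `B`. -/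
def cyclesMatrix (K B : Matrix n n ℂ) : ℕ → Matrix n n ℂ
  | 0 => 0
  | N + 1 => cyclesMatrix K B N + B * (1 - K * cyclesMatrix K B N)

theorem cyclesMatrix_mulVec (K B : Matrix n n ℂ) (b : n → ℂ) (N : ℕ) :
    cyclesMatrix K B N *ᵥ b = (cycle K B b)^[N] 0 := by
  induction N with
  | zero => simp [cyclesMatrix]
  | succ N ih =>
    rw [Function.iterate_succ_apply', ← ih, cycle, cyclesMatrix, Matrix.add_mulVec,
      ← Matrix.mulVec_mulVec, Matrix.sub_mulVec, Matrix.one_mulVec, ← Matrix.mulVec_mulVec]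

/-- The field of values `F(A)`. -/
def fieldOfValues (A : Matrix n n ℂ) : Set ℂ :=
  {z | ∃ x : n → ℂ, x ≠ 0 ∧ z = (star x ⬝ᵥ A *ᵥ x) / (star x ⬝ᵥ x)}

end Iteration

namespace Triangulation

variable {d : ℕ} {Ω : Set (E d)} (T : Triangulation Ω)

/-- `K̃^{-N}`, where `B` is the operator `K̃^{-1}` of one cycle. -/
def inexactInverse (B : Matrix T.nodes T.nodes ℂ) (N : ℕ) : Matrix T.nodes T.nodes ℂ :=
  cyclesMatrix T.stiffness B N

/-- The error propagation operator `E_N : V_h → V_h`, whose matrix is `(K̃^{-N} - K^{-1}) K`. -/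
def errorOperator (B : Matrix T.nodes T.nodes ℂ) (N : ℕ) (u : E d → ℂ) : E d → ℂ :=
  T.ofCoeffs (((T.inexactInverse B N - T.stiffness⁻¹) * T.stiffness) *ᵥ T.coeffs u)

end Triangulation

end Helmholtz

end

/-! Put `P = K̃^{-N} - K⁻¹`. As `A = K + (-κ² + iσ) M`,
`x* A P M x = x* K P M x + (-κ² + iσ) x* M P M x`.
The matrix `P` is Hermitian, because one cycle is symmetric; so `x* M P M x` is real, and `-κ²` and
`iσ` contribute to the real and to the imaginary part separately. It remains to bound the two
quadratic forms by multiples of `x* x`.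

* With `u` the finite element function of `x`, `x* K P M x = (P K x)* M x = (u, E_N u)`, which the
  `L²` contraction bounds by `C₀ γ₀^N ‖u‖₀²`.
* With `w = K⁻¹ M x` the solution of the discrete Poisson problem with right-hand side `u`,
  `x* M P M x = w* K P K w = (∇ E_N w, ∇ w)`, which the `H¹` contraction bounds by
  `C₀ γ₁^N ‖w‖₁²`. Testing with `w` gives `‖∇w‖² = (u, w)`, hence `‖w‖₁ ≤ C ‖u‖₀` by the Poincaré
  inequality (`norm1_sq_le_of_stiffness_mulVec_eq`), which also makes `K` invertible.
* `‖u‖₀² ≤ C h^d x* x` (`norm0_ofCoeffs_sq_le`): by Jensen's inequality `|u|² ≤ ∑ |xᵢ|² φᵢ`, and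
  `φᵢ ≤ 1` is supported in a ball of radius `h`.

The analysis uses that finite element functions, extended by zero, are Lipschitz on the whole space
(`lipschitzWith_of_finite_closed_cover`). Rademacher's theorem then makes their gradients linear
almost everywhere, and the Poincaré inequality (`norm0_le_grad`) follows from integration by parts
for Lipschitz functions, applied to a coordinate function and `|u|²`. -/

open MeasureTheory

namespace Helmholtz

/-! ### Lipschitz bounds from closed covers -/

/-- If finitely many closed sets cover `[a, b]` and `g` is `L`-Lipschitz on each of them, then `g`
is `L`-Lipschitz between the end points: leave a set containing `a` for good at its last point in
`[a, b]`, and continue with the other sets. -/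
theorem dist_le_of_finite_closed_cover_Icc {F ι : Type*} [PseudoMetricSpace F] [DecidableEq ι]
    {A : ι → Set ℝ} (hA : ∀ i, IsClosed (A i)) {g : ℝ → F} {L : ℝ} {b : ℝ} (I : Finset ι)
    (hg : ∀ i ∈ I, ∀ x ∈ A i, ∀ y ∈ A i, dist (g x) (g y) ≤ L * dist x y) :
    ∀ a ≤ b, Set.Icc a b ⊆ ⋃ i ∈ I, A i → dist (g a) (g b) ≤ L * (b - a) := by
  induction I using Finset.strongInduction with
  | H I ih =>
    intro a hab hcov
    obtain ⟨i, hi, hai⟩ := Set.mem_iUnion₂.1 (hcov (Set.left_mem_Icc.2 hab))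
    have hcomp : IsCompact (A i ∩ Set.Icc a b) := isCompact_Icc.inter_left (hA i)
    obtain ⟨t, ⟨hti, hta, htb⟩, htmax⟩ :=
      hcomp.exists_isGreatest ⟨a, hai, Set.left_mem_Icc.2 hab⟩
    have h1 : dist (g a) (g t) ≤ L * (t - a) := by
      have := hg i hi a hai t hti
      rwa [Real.dist_eq, abs_sub_comm, abs_of_nonneg (sub_nonneg.2 hta)] at this
    rcases htb.eq_or_lt with rfl | htb'
    · exact h1
    · have hsub : Set.Icc t b ⊆ ⋃ j ∈ I.erase i, A j := by
        rw [← closure_Ioc htb'.ne]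
        refine closure_minimal (fun x hx => ?_)
          ((I.erase i).finite_toSet.isClosed_biUnion fun j _ => hA j)
        obtain ⟨j, hj, hxj⟩ := Set.mem_iUnion₂.1 (hcov ⟨hta.trans hx.1.le, hx.2⟩)
        refine Set.mem_iUnion₂.2 ⟨j, Finset.mem_erase.2 ⟨?_, hj⟩, hxj⟩
        rintro rfl
        exact absurd (htmax ⟨hxj, hta.trans hx.1.le, hx.2⟩) (not_le.2 hx.1)
      have h2 := ih (I.erase i) (Finset.erase_ssubset hi)
        (fun j hj => hg j (Finset.mem_of_mem_erase hj)) t htb hsub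
      calc dist (g a) (g b) ≤ dist (g a) (g t) + dist (g t) (g b) := dist_triangle _ _ _
        _ ≤ L * (t - a) + L * (b - t) := add_le_add h1 h2
        _ = L * (b - a) := by ring

/-- A function that is `L`-Lipschitz on each of finitely many closed sets that cover a normed
space is `L`-Lipschitz. -/
theorem lipschitzWith_of_finite_closed_cover {V F ι : Type*} [NormedAddCommGroup V]
    [NormedSpace ℝ V] [PseudoMetricSpace F] [Finite ι] {A : ι → Set V}
    (hA : ∀ i, IsClosed (A i)) (hcov : ∀ x, ∃ i, x ∈ A i) {f : V → F} {L : NNReal}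
    (hf : ∀ i, LipschitzOnWith L f (A i)) : LipschitzWith L f := by
  classical
  have := Fintype.ofFinite ι
  refine LipschitzWith.of_dist_le_mul fun x y => ?_
  have h := dist_le_of_finite_closed_cover_Icc
    (A := fun i => AffineMap.lineMap x y ⁻¹' A i) (b := 1) (L := L * dist x y)
    (g := fun t : ℝ => f (AffineMap.lineMap x y t))
    (fun i => (hA i).preimage AffineMap.lineMap_continuous)
    Finset.univ (fun i _ s hs t ht => by
      refine ((hf i).dist_le_mul _ hs _ ht).trans (le_of_eq ?_)
      rw [dist_lineMap_lineMap]; ring) 0 zero_le_one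
    (fun t _ => by simpa using hcov _)
  simpa using h

/-! ### Lipschitz functions vanishing outside a bounded set -/

section LipschitzVanishing

variable {d : ℕ} {Ω : Set (E d)}

/-- Lipschitz functions that vanish outside of `Ω`. They form a subspace of `H¹₀(Ω)` that contains
the finite element functions. -/
def IsLipschitzVanishing (Ω : Set (E d)) (u : E d → ℂ) : Prop :=
  (∃ L, LipschitzWith L u) ∧ ∀ x, x ∉ Ω → u x = 0

/-- The gradient, as a vector with Euclidean norm. -/
noncomputable def grad (u : E d → ℂ) (x : E d) : EuclideanSpace ℂ (Fin d) :=
  WithLp.toLp 2 fun k => partialDeriv k u x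

theorem norm_grad_sq (u : E d → ℂ) (x : E d) :
    ‖grad u x‖ ^ 2 = ∑ k, ‖partialDeriv k u x‖ ^ 2 := by
  rw [EuclideanSpace.norm_sq_eq]; rfl

theorem l2Inner_eq_integral_inner (u v : E d → ℂ) :
    l2Inner Ω u v = ∫ x in Ω, inner ℂ (v x) (u x) := rfl

theorem gradInner_eq_integral_inner (u v : E d → ℂ) :
    gradInner Ω u v = ∫ x in Ω, inner ℂ (grad v x) (grad u x) := by
  simp only [gradInner, PiLp.inner_apply, RCLike.inner_apply]; rfl

theorem norm0_sq (u : E d → ℂ) : norm0 Ω u ^ 2 = ∫ x in Ω, ‖u x‖ ^ 2 :=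
  Real.sq_sqrt (integral_nonneg fun _ => by positivity)

theorem norm1_sq (u : E d → ℂ) :
    norm1 Ω u ^ 2 = (∫ x in Ω, ‖u x‖ ^ 2) + ∫ x in Ω, ‖grad u x‖ ^ 2 := by
  simp only [norm_grad_sq]
  exact Real.sq_sqrt (add_nonneg (integral_nonneg fun _ => by positivity)
    (integral_nonneg fun _ => Finset.sum_nonneg fun _ _ => by positivity))

theorem integral_inner_self {α F : Type*} [MeasurableSpace α] {μ : Measure α}
    [NormedAddCommGroup F] [InnerProductSpace ℂ F] (f : α → F) :
    ∫ x, inner ℂ (f x) (f x) ∂μ = ((∫ x, ‖f x‖ ^ 2 ∂μ : ℝ) : ℂ) := by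
  rw [← integral_complex_ofReal]
  refine integral_congr_ae (Filter.Eventually.of_forall fun x => ?_)
  simp [inner_self_eq_norm_sq_to_K]

/-- The Cauchy-Schwarz inequality in `L²`, for the norms of the factors. -/
theorem integral_norm_mul_norm_le {α F G : Type*} [MeasurableSpace α] {μ : Measure α}
    [NormedAddCommGroup F] [NormedAddCommGroup G] {f : α → F} {g : α → G}
    (hf : MemLp f 2 μ) (hg : MemLp g 2 μ) :
    ∫ x, ‖f x‖ * ‖g x‖ ∂μ ≤ √(∫ x, ‖f x‖ ^ 2 ∂μ) * √(∫ x, ‖g x‖ ^ 2 ∂μ) := by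
  have h := integral_mul_le_Lp_mul_Lq_of_nonneg (μ := μ) Real.HolderConjugate.two_two
    (f := fun x => ‖f x‖) (g := fun x => ‖g x‖)
    (Filter.Eventually.of_forall fun _ => norm_nonneg _)
    (Filter.Eventually.of_forall fun _ => norm_nonneg _)
    (by simpa using hf.norm) (by simpa using hg.norm)
  simpa [Real.sqrt_eq_rpow] using h

theorem norm_integral_inner_le {α F : Type*} [MeasurableSpace α] {μ : Measure α}
    [NormedAddCommGroup F] [InnerProductSpace ℂ F] {f g : α → F}
    (hf : MemLp f 2 μ) (hg : MemLp g 2 μ) :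
    ‖∫ x, inner ℂ (f x) (g x) ∂μ‖ ≤ √(∫ x, ‖f x‖ ^ 2 ∂μ) * √(∫ x, ‖g x‖ ^ 2 ∂μ) := by
  refine le_trans (norm_integral_le_of_norm_le (hf.norm.integrable_mul hg.norm)
    (Filter.Eventually.of_forall fun x => norm_inner_le_norm _ _))
    (integral_norm_mul_norm_le hf hg)

theorem norm_partialDeriv_le {u : E d → ℂ} {L : NNReal} (hu : LipschitzWith L u) (k : Fin d)
    (x : E d) : ‖partialDeriv k u x‖ ≤ L := by
  refine ((fderiv ℝ u x).le_opNorm _).trans ?_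
  simpa using norm_fderiv_le_of_lipschitz ℝ hu

theorem measurable_grad (u : E d → ℂ) : Measurable (grad u) :=
  (WithLp.measurable_toLp 2 _).comp
    (measurable_pi_lambda _ fun _ => measurable_fderiv_apply_const ℝ u _)

namespace IsLipschitzVanishing

variable {u v : E d → ℂ}

theorem continuous (hu : IsLipschitzVanishing Ω u) : Continuous u := by
  obtain ⟨⟨L, hL⟩, -⟩ := hu
  exact hL.continuous

theorem hasCompactSupport (hΩ : Bornology.IsBounded Ω) (hu : IsLipschitzVanishing Ω u) :
    HasCompactSupport u :=
  HasCompactSupport.of_support_subset_isCompact hΩ.isCompact_closure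
    fun x hx => subset_closure (by by_contra h; exact hx (hu.2 x h))

theorem memLp (hΩ : Bornology.IsBounded Ω) (hu : IsLipschitzVanishing Ω u) :
    MemLp u 2 (volume.restrict Ω) :=
  (hu.continuous.memLp_of_hasCompactSupport (hu.hasCompactSupport hΩ)).restrict Ω

theorem memLp_grad (hΩ : Bornology.IsBounded Ω) (hu : IsLipschitzVanishing Ω u) :
    MemLp (grad u) 2 (volume.restrict Ω) := by
  obtain ⟨⟨L, hL⟩, -⟩ := hu
  have : IsFiniteMeasure (volume.restrict Ω) := ⟨by simpa using hΩ.measure_lt_top⟩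
  refine MemLp.of_bound (measurable_grad u).aestronglyMeasurable √(∑ _k : Fin d, (L : ℝ) ^ 2)
    (Filter.Eventually.of_forall fun x => Real.le_sqrt_of_sq_le ?_)
  rw [norm_grad_sq]
  gcongr
  exact norm_partialDeriv_le hL _ _

theorem norm_l2Inner_le (hΩ : Bornology.IsBounded Ω) (hu : IsLipschitzVanishing Ω u)
    (hv : IsLipschitzVanishing Ω v) : ‖l2Inner Ω u v‖ ≤ norm0 Ω u * norm0 Ω v := by
  rw [l2Inner_eq_integral_inner, mul_comm]
  exact norm_integral_inner_le (hv.memLp hΩ) (hu.memLp hΩ)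

theorem norm_gradInner_le_sqrt (hΩ : Bornology.IsBounded Ω) (hu : IsLipschitzVanishing Ω u)
    (hv : IsLipschitzVanishing Ω v) :
    ‖gradInner Ω u v‖ ≤ √(∫ x in Ω, ‖grad u x‖ ^ 2) * √(∫ x in Ω, ‖grad v x‖ ^ 2) := by
  rw [gradInner_eq_integral_inner, mul_comm]
  exact norm_integral_inner_le (hv.memLp_grad hΩ) (hu.memLp_grad hΩ)

theorem norm_gradInner_le (hΩ : Bornology.IsBounded Ω) (hu : IsLipschitzVanishing Ω u)
    (hv : IsLipschitzVanishing Ω v) : ‖gradInner Ω u v‖ ≤ norm1 Ω u * norm1 Ω v := by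
  have key : ∀ w : E d → ℂ, √(∫ x in Ω, ‖grad w x‖ ^ 2) ≤ norm1 Ω w := fun w =>
    Real.sqrt_le_iff.2 ⟨Real.sqrt_nonneg _, by
      rw [norm1_sq]
      exact le_add_of_nonneg_left (integral_nonneg fun _ => by positivity)⟩
  refine (hu.norm_gradInner_le_sqrt hΩ hv).trans ?_
  gcongr
  · exact Real.sqrt_nonneg _
  · exact key u
  · exact key v

/-- A bounded Lipschitz function has a Lipschitz square. -/
theorem exists_lipschitzWith_norm_sq (hΩ : Bornology.IsBounded Ω)
    (hu : IsLipschitzVanishing Ω u) : ∃ L, LipschitzWith L fun x => ‖u x‖ ^ 2 := by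
  obtain ⟨b, hb⟩ := hu.continuous.bounded_above_of_compact_support (hu.hasCompactSupport hΩ)
  obtain ⟨⟨L, hL⟩, -⟩ := hu
  have hb0 : 0 ≤ b := (norm_nonneg _).trans (hb 0)
  refine ⟨(2 * b).toNNReal * L, LipschitzWith.of_dist_le_mul fun x y => ?_⟩
  have h1 : |‖u x‖ - ‖u y‖| ≤ L * dist x y :=
    (abs_norm_sub_norm_le _ _).trans (by simpa [dist_eq_norm] using hL.dist_le_mul x y)
  rw [Real.dist_eq, sq_sub_sq, abs_mul, abs_of_nonneg (by positivity), NNReal.coe_mul,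
    Real.coe_toNNReal _ (by positivity), mul_assoc]
  have h2 : ‖u x‖ + ‖u y‖ ≤ 2 * b := by linarith [hb x, hb y]
  exact mul_le_mul h2 h1 (abs_nonneg _) (by positivity)

/-- Almost everywhere, `|∂ₖ |u|²| ≤ 2 |u| |∇u|`. -/
theorem ae_abs_lineDeriv_norm_sq_le (hu : IsLipschitzVanishing Ω u) (k : Fin d) :
    ∀ᵐ x, |lineDeriv ℝ (fun x => ‖u x‖ ^ 2) x (-EuclideanSpace.single k 1)|
      ≤ 2 * (‖u x‖ * ‖grad u x‖) := by
  obtain ⟨⟨L, hL⟩, -⟩ := hu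
  filter_upwards [hL.ae_differentiableAt] with x hx
  have h := hx.hasFDerivAt.norm_sq
  rw [h.differentiableAt.lineDeriv_eq_fderiv, h.fderiv, map_neg, abs_neg]
  have h1 : ‖partialDeriv k u x‖ ≤ ‖grad u x‖ := PiLp.norm_apply_le (grad u x) k
  have h2 := (abs_real_inner_le_norm (u x) (partialDeriv k u x)).trans
    (mul_le_mul_of_nonneg_left h1 (norm_nonneg _))
  have h3 : (2 • (innerSL ℝ) (u x) ∘SL fderiv ℝ u x) (EuclideanSpace.single k 1) =
      2 * inner ℝ (u x) (partialDeriv k u x) := by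
    rw [two_smul, two_mul]; rfl
  rw [h3, abs_mul, abs_two]
  linarith

/-- The Poincaré inequality: integrate `∂ₖ xₖ = 1` against `|u|²` by parts. -/
theorem norm0_le_grad (hΩ : MeasurableSet Ω) {R : ℝ} (hR0 : 0 ≤ R)
    (hR : Ω ⊆ Metric.closedBall 0 R)
    (hu : IsLipschitzVanishing Ω u) (k : Fin d) :
    norm0 Ω u ≤ 2 * R * √(∫ x in Ω, ‖grad u x‖ ^ 2) := by
  have hbdd : Bornology.IsBounded Ω := Metric.isBounded_closedBall.subset hR
  obtain ⟨L, hL⟩ := hu.exists_lipschitzWith_norm_sq hbdd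
  have hcoord : LipschitzWith 1 (fun x : E d => x k) :=
    LipschitzWith.of_dist_le_mul fun x y => by
      simpa [dist_eq_norm] using PiLp.norm_apply_le (x - y) k
  have hsupp : HasCompactSupport fun x => ‖u x‖ ^ 2 :=
    (hu.hasCompactSupport hbdd).comp_left (g := fun z : ℂ => ‖z‖ ^ 2) (by simp)
  have hparts := hcoord.integral_lineDeriv_mul_eq (μ := volume) hL hsupp
    (EuclideanSpace.single k (1 : ℝ))
  have hd1 : ∀ x : E d, lineDeriv ℝ (fun x : E d => x k) x (EuclideanSpace.single k 1) = 1 := by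
    intro x
    have h := (EuclideanSpace.proj k : E d →L[ℝ] ℝ).hasFDerivAt (x := x)
    have h' : lineDeriv ℝ (fun x : E d => x k) x (EuclideanSpace.single k 1) =
        (EuclideanSpace.proj k : E d →L[ℝ] ℝ) (EuclideanSpace.single k 1) :=
      (h.hasLineDerivAt _).lineDeriv
    simpa using h'
  simp only [hd1, one_mul] at hparts
  have hint : Integrable (fun x => 2 * R * (‖u x‖ * ‖grad u x‖)) (volume.restrict Ω) :=
    ((hu.memLp hbdd).norm.integrable_mul (hu.memLp_grad hbdd).norm).const_mul _
  have hvan : ∀ x, x ∉ Ω → ‖u x‖ ^ 2 = 0 := fun x hx => by simp [hu.2 x hx]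
  have h1 : norm0 Ω u ^ 2 ≤ 2 * R * (norm0 Ω u * √(∫ x in Ω, ‖grad u x‖ ^ 2)) := by
    calc norm0 Ω u ^ 2 = ∫ x, ‖u x‖ ^ 2 := by
          rw [norm0_sq, setIntegral_eq_integral_of_forall_compl_eq_zero hvan]
      _ ≤ ‖∫ x, lineDeriv ℝ (fun x => ‖u x‖ ^ 2) x (-EuclideanSpace.single k 1) * x k‖ := by
          rw [hparts]; exact Real.le_norm_self _
      _ ≤ ∫ x, Ω.indicator (fun x => 2 * R * (‖u x‖ * ‖grad u x‖)) x := by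
          refine norm_integral_le_of_norm_le ((integrable_indicator_iff hΩ).2 hint) ?_
          filter_upwards [hu.ae_abs_lineDeriv_norm_sq_le k] with x hx
          rw [norm_mul, Real.norm_eq_abs]
          by_cases hxΩ : x ∈ Ω
          · rw [Set.indicator_of_mem hxΩ]
            have hxR : ‖x k‖ ≤ R :=
              (PiLp.norm_apply_le x k).trans (mem_closedBall_zero_iff.1 (hR hxΩ))
            calc _ ≤ 2 * (‖u x‖ * ‖grad u x‖) * R :=
                  mul_le_mul hx hxR (norm_nonneg _) (by positivity)
              _ = _ := by ring
          · rw [Set.indicator_of_notMem hxΩ]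
            have h0 : |lineDeriv ℝ (fun x => ‖u x‖ ^ 2) x (-EuclideanSpace.single k 1)| ≤ 0 := by
              simpa [hu.2 x hxΩ] using hx
            rw [le_antisymm h0 (abs_nonneg _), zero_mul]
      _ = 2 * R * ∫ x in Ω, ‖u x‖ * ‖grad u x‖ := by
          rw [integral_indicator hΩ, integral_const_mul]
      _ ≤ _ := by
          gcongr
          exact integral_norm_mul_norm_le (hu.memLp hbdd) (hu.memLp_grad hbdd)
  have hn : 0 ≤ norm0 Ω u := Real.sqrt_nonneg _
  rcases hn.eq_or_lt with h0 | h0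
  · rw [← h0]; positivity
  · refine le_of_mul_le_mul_left ?_ h0
    calc norm0 Ω u * norm0 Ω u = norm0 Ω u ^ 2 := (sq _).symm
      _ ≤ _ := h1
      _ = _ := by ring

theorem eq_zero_of_norm0_eq_zero (hΩ : Bornology.IsBounded Ω) (hu : IsLipschitzVanishing Ω u)
    (h0 : norm0 Ω u = 0) : u = 0 := by
  have h1 : ∫ x, ‖u x‖ ^ 2 = 0 := by
    rw [← setIntegral_eq_integral_of_forall_compl_eq_zero (s := Ω)
      (fun x hx => by simp [hu.2 x hx]), ← norm0_sq, h0]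
    simp
  have hint : Integrable (fun x => ‖u x‖ ^ 2) :=
    by
    have hc : Continuous fun x => ‖u x‖ ^ 2 := hu.continuous.norm.pow 2
    exact hc.integrable_of_hasCompactSupport
      ((hu.hasCompactSupport hΩ).comp_left (g := fun z : ℂ => ‖z‖ ^ 2) (by simp))
  rw [integral_eq_zero_iff_of_nonneg (fun _ => by positivity) hint] at h1
  refine (Continuous.ae_eq_iff_eq volume hu.continuous continuous_zero).1 ?_
  filter_upwards [h1] with x hx
  simpa using hx

end IsLipschitzVanishing

theorem isLipschitzVanishing_sum {ι : Type*} (s : Finset ι) (c : ι → ℂ) {φ : ι → E d → ℂ}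
    (hφ : ∀ i, IsLipschitzVanishing Ω (φ i)) :
    IsLipschitzVanishing Ω fun x => ∑ i ∈ s, c i * φ i x := by
  classical
  refine ⟨?_, fun x hx => Finset.sum_eq_zero fun i _ => by rw [(hφ i).2 x hx, mul_zero]⟩
  induction s using Finset.induction_on with
  | empty => exact ⟨0, by simp⟩
  | insert a s ha ih =>
    obtain ⟨L, hL⟩ := ih
    obtain ⟨L', hL'⟩ := (hφ a).1
    simp only [Finset.sum_insert ha]
    exact ⟨_, ((lipschitzWith_smul (c a)).comp hL').add hL⟩

/-- Almost everywhere, by Rademacher's theorem, the gradient is linear. -/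
theorem ae_grad_sum {ι : Type*} [Fintype ι] (c : ι → ℂ) {φ : ι → E d → ℂ}
    (hφ : ∀ i, IsLipschitzVanishing Ω (φ i)) :
    ∀ᵐ x, grad (fun x => ∑ i, c i * φ i x) x = ∑ i, c i • grad (φ i) x := by
  have h : ∀ᵐ x, ∀ i, DifferentiableAt ℝ (φ i) x := by
    rw [ae_all_iff]
    intro i
    obtain ⟨⟨L, hL⟩, -⟩ := hφ i
    exact hL.ae_differentiableAt
  filter_upwards [h] with x hx
  ext k
  have h1 : HasFDerivAt (fun x => ∑ i, c i * φ i x) (∑ i, c i • fderiv ℝ (φ i) x) x :=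
    HasFDerivAt.fun_sum fun i _ => (hx i).hasFDerivAt.const_mul (c i)
  simp [grad, partialDeriv, h1.fderiv]

theorem integral_inner_sum {α F ι : Type*} [Fintype ι] [MeasurableSpace α] {μ : Measure α}
    [NormedAddCommGroup F] [InnerProductSpace ℂ F] {f : ι → α → F} (hf : ∀ i, MemLp (f i) 2 μ)
    (a b : ι → ℂ) :
    ∫ x, inner ℂ (∑ j, b j • f j x) (∑ i, a i • f i x) ∂μ =
      star b ⬝ᵥ (Matrix.of fun j i => ∫ x, inner ℂ (f j x) (f i x) ∂μ) *ᵥ a := by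
  have hint : ∀ j i, Integrable (fun x => inner ℂ (f j x) (f i x)) μ := fun j i =>
    (hf j).norm.integrable_mul (hf i).norm |>.mono'
      ((hf j).aestronglyMeasurable.inner (hf i).aestronglyMeasurable)
      (Filter.Eventually.of_forall fun x => norm_inner_le_norm _ _)
  simp only [sum_inner, inner_sum, inner_smul_left, inner_smul_right, Finset.mul_sum]
  rw [integral_finsetSum _ fun i _ => integrable_finsetSum _ fun j _ =>
    ((hint _ _).const_mul _).const_mul _]
  simp only [dotProduct, Matrix.mulVec, Finset.mul_sum]
  conv_rhs => rw [Finset.sum_comm]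
  refine Finset.sum_congr rfl fun i _ => ?_
  rw [integral_finsetSum _ fun j _ => ((hint _ _).const_mul _).const_mul _]
  refine Finset.sum_congr rfl fun j _ => ?_
  rw [integral_const_mul, integral_const_mul]
  simp only [Matrix.of_apply, Pi.star_apply, RCLike.star_def]
  ring

end LipschitzVanishing

/-! ### Nodal basis functions -/

namespace Triangulation

variable {d : ℕ} {Ω : Set (E d)} (T : Triangulation Ω)

theorem barycentric_eq {x : E d} {w : E d → ℝ} (hw : T.IsBarycentric x w) :
    T.barycentric x = w := by
  have hx : ∃ w, T.IsBarycentric x w := ⟨w, hw⟩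
  rw [barycentric, dif_pos hx]
  exact hx.choose_spec.unique hw

/-- In every simplex that contains `x`, the barycentric coordinates of `x` are given by
`T.barycentric x`. -/
theorem barycentric_spec {s : Finset (E d)} (hs : s ∈ T.complex.faces) {x : E d}
    (hx : x ∈ convexHull ℝ (s : Set (E d))) :
    (∀ y ∈ s, 0 ≤ T.barycentric x y) ∧ (∀ y, y ∉ s → T.barycentric x y = 0) ∧
      ∑ y ∈ s, T.barycentric x y = 1 ∧ ∑ y ∈ s, T.barycentric x y • y = x := by
  classical
  obtain ⟨w, hw0, hw1, hwx⟩ := Finset.mem_convexHull'.1 hx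
  have hw' : (∀ y ∈ s, 0 ≤ (if y ∈ s then w y else 0)) ∧
      (∀ y, y ∉ s → (if y ∈ s then w y else 0) = 0) ∧
      ∑ y ∈ s, (if y ∈ s then w y else 0) = 1 ∧
      ∑ y ∈ s, (if y ∈ s then w y else 0) • y = x := by
    refine ⟨fun y hy => by rw [if_pos hy]; exact hw0 y hy, fun y hy => if_neg hy, ?_, ?_⟩
    · rw [← hw1]; exact Finset.sum_congr rfl fun y hy => if_pos hy
    · rw [← hwx]; exact Finset.sum_congr rfl fun y hy => by rw [if_pos hy]
  rw [T.barycentric_eq ⟨s, hs, hw'⟩]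
  exact hw'

theorem exists_face_of_barycentric_ne_zero {x v : E d} (h : T.barycentric x v ≠ 0) :
    ∃ s ∈ T.complex.faces, x ∈ convexHull ℝ (s : Set (E d)) := by
  by_cases hx : ∃ w, T.IsBarycentric x w
  · obtain ⟨w, s, hs, hw0, -, hw1, hwx⟩ := hx
    exact ⟨s, hs, Finset.mem_convexHull'.2 ⟨w, hw0, hw1, hwx⟩⟩
  · rw [barycentric, dif_neg hx] at h
    exact absurd rfl h

theorem barycentric_nonneg (x v : E d) : 0 ≤ T.barycentric x v := by
  by_cases h : T.barycentric x v = 0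
  · exact h.ge
  · obtain ⟨s, hs, hx⟩ := T.exists_face_of_barycentric_ne_zero h
    by_cases hv : v ∈ s
    · exact (T.barycentric_spec hs hx).1 v hv
    · exact ((T.barycentric_spec hs hx).2.1 v hv).ge

theorem sum_barycentric_le_one (x : E d) : ∑ v : T.nodes, T.barycentric x v ≤ 1 := by
  classical
  rw [Finset.sum_coe_sort T.nodes (T.barycentric x)]
  by_cases h : ∀ v ∈ T.nodes, T.barycentric x v = 0
  · rw [Finset.sum_eq_zero h]
    exact zero_le_one
  · push Not at h
    obtain ⟨v, -, hv⟩ := h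
    obtain ⟨s, hs, hx⟩ := T.exists_face_of_barycentric_ne_zero hv
    obtain ⟨-, h0, h1, -⟩ := T.barycentric_spec hs hx
    rw [← h1, ← Finset.sum_inter_add_sum_sdiff T.nodes s,
      Finset.sum_eq_zero (s := T.nodes \ s) fun y hy => h0 y (Finset.mem_sdiff.1 hy).2, add_zero]
    exact Finset.sum_le_sum_of_subset_of_nonneg Finset.inter_subset_right
      fun y _ _ => T.barycentric_nonneg x y

theorem exists_face_of_mem_nodes {v : E d} (hv : v ∈ T.nodes) :
    ∃ s ∈ T.complex.faces, v ∈ s := by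
  classical
  simpa [nodes, allNodes] using (Finset.mem_filter.1 hv).1

theorem mem_of_mem_nodes {v : E d} (hv : v ∈ T.nodes) : v ∈ Ω := by
  classical
  exact (Finset.mem_filter.1 hv).2

theorem hat_apply_node [DecidableEq T.nodes] (v w : T.nodes) :
    T.hat v w = if v = w then 1 else 0 := by
  obtain ⟨s, hs, hw⟩ := T.exists_face_of_mem_nodes w.2
  have hw' : ({(w : E d)} : Finset (E d)) ∈ T.complex.faces :=
    T.complex.down_closed hs (Finset.singleton_subset_iff.2 hw) (Finset.singleton_nonempty _)
  obtain ⟨-, h0, h1, -⟩ := T.barycentric_spec hw' (x := w) (by simp)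
  split_ifs with h
  · subst h
    simpa [hat] using h1
  · have := h0 v fun hm => h (Subtype.ext (Finset.mem_singleton.1 hm))
    simp [hat, this]

theorem coeffs_ofCoeffs (c : T.nodes → ℂ) : T.coeffs (T.ofCoeffs c) = c := by
  classical
  funext w
  simp only [coeffs, ofCoeffs, hat_apply_node, mul_ite, mul_one, mul_zero, Finset.sum_ite_eq',
    Finset.mem_univ, if_true]

/-- Since the mesh resolves the boundary, the basis functions of interior nodes vanish outside of
`Ω`. -/
theorem hat_eq_zero_of_notMem (hΩ : IsOpen Ω) (v : T.nodes) {x : E d} (hx : x ∉ Ω) :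
    T.hat v x = 0 := by
  by_contra h
  have h' : T.barycentric x v ≠ 0 := by simpa [hat] using h
  have hxc : x ∈ closure Ω := by
    rw [← T.space_eq, Geometry.SimplicialComplex.mem_space_iff]
    exact T.exists_face_of_barycentric_ne_zero h'
  obtain ⟨s, hs, -, hxs, hsub⟩ :=
    T.resolves_boundary x (by rw [hΩ.frontier_eq]; exact ⟨hxc, hx⟩)
  refine h' ((T.barycentric_spec hs hxs).2.1 v fun hv => ?_)
  have hvf : (v : E d) ∈ frontier Ω := hsub (subset_convexHull ℝ _ hv)
  rw [hΩ.frontier_eq] at hvf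
  exact hvf.2 (T.mem_of_mem_nodes v.2)

theorem exists_affineMap_eqOn_hat {s : Finset (E d)} (hs : s ∈ T.elements) (v : E d) :
    ∃ g : E d →ᵃ[ℝ] ℂ, Set.EqOn (T.hat v) g (convexHull ℝ (s : Set (E d))) := by
  by_cases hv : v ∈ s
  · have hind := T.complex.indep hs.1
    let b : AffineBasis s ℝ (E d) := ⟨Subtype.val, hind, by
      have := hind.affineSpan_eq_top_iff_card_eq_finrank_add_one
      rw [this]
      simpa using hs.2⟩
    refine ⟨Complex.ofRealLI.toLinearMap.toAffineMap.comp (b.coord ⟨v, hv⟩), fun x hx => ?_⟩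
    obtain ⟨-, -, h1, hxs⟩ := T.barycentric_spec hs.1 hx
    have h1' : ∑ y : s, T.barycentric x y = 1 := by
      rw [Finset.sum_coe_sort s (T.barycentric x)]; exact h1
    have hcomb : Finset.univ.affineCombination ℝ b (fun y : s => T.barycentric x y) = x := by
      rw [Finset.affineCombination_eq_linear_combination _ _ _ h1']
      exact (Finset.sum_coe_sort s fun y => T.barycentric x y • y).trans hxs
    have hcoord := b.coord_apply_combination_of_mem (Finset.mem_univ (⟨v, hv⟩ : s)) h1'
    rw [hcomb] at hcoord
    simp [hat, hcoord]
  · refine ⟨0, fun x hx => ?_⟩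
    simp [hat, (T.barycentric_spec hs.1 hx).2.1 v hv]

theorem finite_elements : T.elements.Finite :=
  T.finite_faces.subset fun _ hs => hs.1

theorem exists_element_of_mem_closure {x : E d} (hx : x ∈ closure Ω) :
    ∃ s ∈ T.elements, x ∈ convexHull ℝ (s : Set (E d)) := by
  rw [← T.space_eq, Geometry.SimplicialComplex.mem_space_iff] at hx
  obtain ⟨s, hs, hxs⟩ := hx
  obtain ⟨t, ht, hst, hcard⟩ := T.pure_dim s hs
  exact ⟨t, ⟨ht, hcard⟩, convexHull_mono (by exact_mod_cast hst) hxs⟩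

theorem isLipschitzVanishing_hat (hΩ : IsOpen Ω) (v : T.nodes) :
    IsLipschitzVanishing Ω (T.hat v) := by
  refine ⟨?_, fun x hx => T.hat_eq_zero_of_notMem hΩ v hx⟩
  have := T.finite_elements.to_subtype
  have := Fintype.ofFinite T.elements
  have hL : ∀ s : T.elements, ∃ L, LipschitzOnWith L (T.hat v)
      (convexHull ℝ ((s : Finset (E d)) : Set (E d))) := fun s => by
    obtain ⟨g, hg⟩ := T.exists_affineMap_eqOn_hat s.2 v
    obtain ⟨L, hL⟩ := g.lipschitzWith_of_finiteDimensional
    exact ⟨L, fun x hx y hy => by rw [hg hx, hg hy]; exact hL x y⟩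
  choose L hL using hL
  refine ⟨Finset.univ.sup L, lipschitzWith_of_finite_closed_cover
    (A := fun i : Option T.elements =>
      i.elim Ωᶜ fun s => convexHull ℝ ((s : Finset (E d)) : Set (E d))) ?_ ?_ ?_⟩
  · rintro (_ | s)
    · exact hΩ.isClosed_compl
    · exact (s : Finset (E d)).finite_toSet.isClosed_convexHull ℝ
  · intro x
    by_cases hx : x ∈ Ω
    · obtain ⟨s, hs, hxs⟩ := T.exists_element_of_mem_closure (subset_closure hx)
      exact ⟨some ⟨s, hs⟩, hxs⟩
    · exact ⟨none, hx⟩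
  · rintro (_ | s)
    · intro x hx y hy
      rw [T.hat_eq_zero_of_notMem hΩ v hx, T.hat_eq_zero_of_notMem hΩ v hy]
      simp
    · exact (hL s).weaken (Finset.le_sup (Finset.mem_univ s))

theorem isLipschitzVanishing_ofCoeffs (hΩ : IsOpen Ω) (c : T.nodes → ℂ) :
    IsLipschitzVanishing Ω (T.ofCoeffs c) :=
  isLipschitzVanishing_sum _ c (T.isLipschitzVanishing_hat hΩ)

theorem ofCoeffs_mem_feSpace (hΩ : IsOpen Ω) (c : T.nodes → ℂ) : T.ofCoeffs c ∈ T.feSpace := by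
  have h := T.isLipschitzVanishing_ofCoeffs hΩ c
  refine ⟨h.continuous, fun s hs => ?_, h.2⟩
  choose g hg using fun v => T.exists_affineMap_eqOn_hat hs v
  refine ⟨∑ v : T.nodes, c v • g v, fun x hx => ?_⟩
  have hsum : (∑ v : T.nodes, c v • g v) x = ∑ v : T.nodes, (c v • g v) x :=
    map_sum (⟨⟨fun f : E d →ᵃ[ℝ] ℂ => f x, rfl⟩, fun _ _ => rfl⟩ : (E d →ᵃ[ℝ] ℂ) →+ ℂ) _ _
  rw [hsum]
  exact Finset.sum_congr rfl fun v _ => by rw [hg v hx]; rfl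

/-! ### Mass and stiffness matrix -/

theorem l2Inner_ofCoeffs (hΩ : IsOpen Ω) (hΩb : Bornology.IsBounded Ω) (a b : T.nodes → ℂ) :
    l2Inner Ω (T.ofCoeffs a) (T.ofCoeffs b) = star b ⬝ᵥ T.mass *ᵥ a := by
  rw [l2Inner_eq_integral_inner]
  exact integral_inner_sum (fun v : T.nodes => (T.isLipschitzVanishing_hat hΩ v).memLp hΩb) a b

theorem gradInner_ofCoeffs (hΩ : IsOpen Ω) (hΩb : Bornology.IsBounded Ω) (a b : T.nodes → ℂ) :
    gradInner Ω (T.ofCoeffs a) (T.ofCoeffs b) = star b ⬝ᵥ T.stiffness *ᵥ a := by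
  have hφ := T.isLipschitzVanishing_hat hΩ
  have h := integral_inner_sum (fun v : T.nodes => (hφ v).memLp_grad hΩb) a b
  have hK : T.stiffness = Matrix.of fun j i : T.nodes =>
      ∫ x in Ω, inner ℂ (grad (T.hat j) x) (grad (T.hat i) x) := by
    ext j i
    exact gradInner_eq_integral_inner _ _
  rw [gradInner_eq_integral_inner, hK, ← h]
  refine integral_congr_ae (ae_restrict_of_ae ?_)
  filter_upwards [ae_grad_sum a hφ, ae_grad_sum b hφ] with x ha hb
  rw [← ha, ← hb]
  rfl

theorem isHermitian_mass : T.mass.IsHermitian := by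
  ext i j
  simp only [mass, Matrix.conjTranspose_apply, Matrix.of_apply, l2Inner, RCLike.star_def]
  rw [← integral_conj]
  simp [mul_comm]

theorem isHermitian_stiffness : T.stiffness.IsHermitian := by
  ext i j
  simp only [stiffness, Matrix.conjTranspose_apply, Matrix.of_apply, gradInner, RCLike.star_def]
  rw [← integral_conj]
  simp [mul_comm]

theorem systemMatrix_eq (κ σ : ℝ) :
    T.systemMatrix κ σ =
      T.stiffness + ((-κ ^ 2 : ℝ) + Complex.I * (σ : ℝ) : ℂ) • T.mass := by
  ext i j
  simp only [systemMatrix, stiffness, mass, helmholtzForm, Matrix.add_apply, Matrix.smul_apply,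
    Matrix.of_apply, smul_eq_mul]
  push_cast
  ring

/-- A basis function is supported in the ball around its node whose radius is the mesh size. -/
theorem mem_closedBall_of_barycentric_ne_zero {x v : E d} (h : T.barycentric x v ≠ 0) :
    x ∈ Metric.closedBall v T.meshSize := by
  obtain ⟨s, hs, hx⟩ := T.exists_face_of_barycentric_ne_zero h
  have hv : v ∈ s := by
    by_contra hv
    exact h ((T.barycentric_spec hs hx).2.1 v hv)
  obtain ⟨t, ht, hst, hcard⟩ := T.pure_dim s hs
  have hst' : (s : Set (E d)) ⊆ t := by exact_mod_cast hst
  have := T.finite_elements.to_subtype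
  rw [Metric.mem_closedBall]
  calc dist x v ≤ Metric.diam (convexHull ℝ (t : Set (E d))) :=
        Metric.dist_le_diam_of_mem (isBounded_convexHull.2 t.finite_toSet.isBounded)
          (convexHull_mono hst' hx) (subset_convexHull ℝ _ (hst' hv))
    _ ≤ T.meshSize := le_ciSup
        (f := fun s : T.elements => Metric.diam (convexHull ℝ ((s : Finset (E d)) : Set (E d))))
        (Set.finite_range _).bddAbove ⟨t, ht, hcard⟩

theorem meshSize_nonneg : 0 ≤ T.meshSize :=
  Real.iSup_nonneg fun _ => Metric.diam_nonneg

/-- Jensen's inequality for the barycentric coordinates. -/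
theorem norm_ofCoeffs_sq_le (c : T.nodes → ℂ) (x : E d) :
    ‖T.ofCoeffs c x‖ ^ 2 ≤ ∑ v : T.nodes, ‖c v‖ ^ 2 * T.barycentric x v := by
  have hb := T.barycentric_nonneg x
  calc ‖T.ofCoeffs c x‖ ^ 2 ≤ (∑ v : T.nodes, ‖c v‖ * T.barycentric x v) ^ 2 := by
        gcongr
        refine (norm_sum_le _ _).trans (le_of_eq (Finset.sum_congr rfl fun v _ => ?_))
        simp [hat, abs_of_nonneg (hb v)]
    _ ≤ (∑ v : T.nodes, T.barycentric x v) * ∑ v : T.nodes, ‖c v‖ ^ 2 * T.barycentric x v :=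
        Finset.sum_sq_le_sum_mul_sum_of_sq_le_mul _ (fun v _ => hb v)
          (fun v _ => mul_nonneg (by positivity) (hb v)) fun v _ => le_of_eq (by ring)
    _ ≤ _ := mul_le_of_le_one_left
        (Finset.sum_nonneg fun v _ => mul_nonneg (by positivity) (hb v))
        (T.sum_barycentric_le_one x)

/-- The mass matrix is bounded by `h ^ d` times the volume of the unit ball. -/
theorem norm0_ofCoeffs_sq_le (hΩ : IsOpen Ω) (c : T.nodes → ℂ) :
    norm0 Ω (T.ofCoeffs c) ^ 2 ≤
      volume.real (Metric.ball (0 : E d) 1) * T.meshSize ^ d * ∑ v, ‖c v‖ ^ 2 := by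
  have hvan : ∀ x, x ∉ Ω → ‖T.ofCoeffs c x‖ ^ 2 = 0 := fun x hx => by
    simp [(T.isLipschitzVanishing_ofCoeffs hΩ c).2 x hx]
  have hint : ∀ v : T.nodes, Integrable fun x : E d =>
      ‖c v‖ ^ 2 * (Metric.closedBall (v : E d) T.meshSize).indicator (fun _ => (1 : ℝ)) x :=
    fun v => ((integrable_indicator_iff measurableSet_closedBall).2
      (integrableOn_const measure_closedBall_lt_top.ne)).const_mul _
  rw [norm0_sq, setIntegral_eq_integral_of_forall_compl_eq_zero hvan]
  calc ∫ x, ‖T.ofCoeffs c x‖ ^ 2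
      ≤ ∫ x, ∑ v : T.nodes, ‖c v‖ ^ 2 *
          (Metric.closedBall (v : E d) T.meshSize).indicator (fun _ => (1 : ℝ)) x := by
        refine integral_mono_of_nonneg (Filter.Eventually.of_forall fun _ => by positivity)
          (integrable_finsetSum _ fun v _ => hint v) (Filter.Eventually.of_forall fun x => ?_)
        refine (T.norm_ofCoeffs_sq_le c x).trans (Finset.sum_le_sum fun v _ => ?_)
        gcongr
        by_cases h : T.barycentric x v = 0
        · rw [h]
          exact Set.indicator_nonneg (fun _ _ => zero_le_one) _
        · rw [Set.indicator_of_mem (T.mem_closedBall_of_barycentric_ne_zero h)]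
          exact (Finset.single_le_sum (f := fun v : T.nodes => T.barycentric x v)
            (fun w _ => T.barycentric_nonneg x w) (Finset.mem_univ v)).trans
            (T.sum_barycentric_le_one x)
    _ = _ := by
        rw [integral_finsetSum _ fun v _ => hint v, Finset.mul_sum]
        refine Finset.sum_congr rfl fun v _ => ?_
        rw [integral_const_mul, integral_indicator_const _ measurableSet_closedBall,
          measureReal_def, Measure.addHaar_closedBall _ _ T.meshSize_nonneg, ENNReal.toReal_mul,
          ENNReal.toReal_ofReal (pow_nonneg T.meshSize_nonneg _), finrank_euclideanSpace_fin,
          measureReal_def, smul_eq_mul]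
        ring

end Triangulation

/-! ### The iteration and the two quadratic forms -/

theorem cyclesMatrix_mul_mul_comm {n : Type*} [Fintype n] [DecidableEq n] (K B : Matrix n n ℂ)
    (N : ℕ) : cyclesMatrix K B N * K * B = B * K * cyclesMatrix K B N := by
  induction N with
  | zero => simp [cyclesMatrix]
  | succ N ih =>
    simp only [cyclesMatrix, add_mul, mul_add, mul_sub, sub_mul, mul_one, mul_assoc] at ih ⊢
    rw [ih]

/-- The matrix `S` of `N` cycles of a symmetric iteration is Hermitian; the inductive step uses
`S K B = B K S`. -/
theorem isHermitian_cyclesMatrix {n : Type*} [Fintype n] [DecidableEq n] {K B : Matrix n n ℂ}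
    (hK : K.IsHermitian) (hB : B.IsHermitian) (N : ℕ) : (cyclesMatrix K B N).IsHermitian := by
  induction N with
  | zero => exact Matrix.isHermitian_zero
  | succ N ih =>
    have hcomm := cyclesMatrix_mul_mul_comm K B N
    rw [Matrix.IsHermitian, cyclesMatrix, mul_sub, mul_one, Matrix.conjTranspose_add,
      Matrix.conjTranspose_sub, Matrix.conjTranspose_mul, Matrix.conjTranspose_mul, ih.eq, hK.eq,
      hB.eq, hcomm, mul_assoc]

namespace Triangulation

variable {d : ℕ} {Ω : Set (E d)} (T : Triangulation Ω)

/-- The stability estimate for the discrete Poisson problem: if `w` is the finite element solution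
with right-hand side `u`, then `‖∇w‖² = (u, w)`, and the Poincaré inequality applies. -/
theorem norm1_sq_le_of_stiffness_mulVec_eq (hΩ : IsOpen Ω) {R : ℝ} (hR0 : 0 ≤ R)
    (hR : Ω ⊆ Metric.closedBall 0 R) (k : Fin d) {x w : T.nodes → ℂ}
    (h : T.stiffness *ᵥ w = T.mass *ᵥ x) :
    norm1 Ω (T.ofCoeffs w) ^ 2 ≤
      ((2 * R) ^ 2 + (2 * R) ^ 4) * norm0 Ω (T.ofCoeffs x) ^ 2 := by
  have hb : Bornology.IsBounded Ω := Metric.isBounded_closedBall.subset hR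
  have hu := T.isLipschitzVanishing_ofCoeffs hΩ x
  have hw := T.isLipschitzVanishing_ofCoeffs hΩ w
  have hP := hw.norm0_le_grad hΩ.measurableSet hR0 hR k
  have hn0 : 0 ≤ norm0 Ω (T.ofCoeffs x) := Real.sqrt_nonneg _
  have hGsq : √(∫ y in Ω, ‖grad (T.ofCoeffs w) y‖ ^ 2) ^ 2 =
      ∫ y in Ω, ‖grad (T.ofCoeffs w) y‖ ^ 2 :=
    Real.sq_sqrt (integral_nonneg fun _ => by positivity)
  have hG0 : 0 ≤ √(∫ y in Ω, ‖grad (T.ofCoeffs w) y‖ ^ 2) := Real.sqrt_nonneg _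
  have hweak : ((∫ y in Ω, ‖grad (T.ofCoeffs w) y‖ ^ 2 : ℝ) : ℂ) =
      l2Inner Ω (T.ofCoeffs x) (T.ofCoeffs w) := by
    rw [← integral_inner_self, ← gradInner_eq_integral_inner, T.gradInner_ofCoeffs hΩ hb, h,
      T.l2Inner_ofCoeffs hΩ hb]
  have h1 := hu.norm_l2Inner_le hb hw
  rw [← hweak, Complex.norm_real, ← hGsq, Real.norm_of_nonneg (sq_nonneg _)] at h1
  rw [norm1_sq, ← norm0_sq, ← hGsq]
  generalize √(∫ y in Ω, ‖grad (T.ofCoeffs w) y‖ ^ 2) = G at *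
  generalize norm0 Ω (T.ofCoeffs x) = a at *
  have hw0 : 0 ≤ norm0 Ω (T.ofCoeffs w) := Real.sqrt_nonneg _
  generalize norm0 Ω (T.ofCoeffs w) = c at *
  have h2 : G ≤ 2 * R * a := by
    rcases hG0.eq_or_lt with rfl | hG
    · positivity
    · refine le_of_mul_le_mul_left ?_ hG
      calc G * G = G ^ 2 := (sq _).symm
        _ ≤ a * c := h1
        _ ≤ a * (2 * R * G) := by gcongr
        _ = G * (2 * R * a) := by ring
  calc c ^ 2 + G ^ 2 ≤ (2 * R * (2 * R * a)) ^ 2 + (2 * R * a) ^ 2 := by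
        gcongr
        exact hP.trans (by gcongr)
    _ = _ := by ring

theorem isUnit_stiffness_det (hΩ : IsOpen Ω) (hb : Bornology.IsBounded Ω) (k : Fin d) :
    IsUnit T.stiffness.det := by
  rw [isUnit_iff_ne_zero]
  intro h0
  obtain ⟨w, hw0, hw⟩ := Matrix.exists_mulVec_eq_zero_iff.2 h0
  obtain ⟨R, hR⟩ := hb.subset_closedBall 0
  have hR' : Ω ⊆ Metric.closedBall 0 (max R 0) :=
    hR.trans (Metric.closedBall_subset_closedBall (le_max_left _ _))
  have h := T.norm1_sq_le_of_stiffness_mulVec_eq hΩ (le_max_right R 0) hR' k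
    (x := 0) (w := w) (by rw [hw, Matrix.mulVec_zero])
  have hzero : T.ofCoeffs 0 = 0 := by
    funext y
    simp [ofCoeffs]
  have hz : norm0 Ω (0 : E d → ℂ) = 0 := by simp [norm0]
  rw [hzero, hz, norm1_sq, ← norm0_sq] at h
  have hg : 0 ≤ ∫ y in Ω, ‖grad (T.ofCoeffs w) y‖ ^ 2 := integral_nonneg fun _ => by positivity
  have hn : norm0 Ω (T.ofCoeffs w) = 0 := by
    refine pow_eq_zero_iff two_ne_zero |>.1 (le_antisymm ?_ (sq_nonneg _))
    linarith
  refine hw0 ?_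
  rw [← T.coeffs_ofCoeffs w,
    (T.isLipschitzVanishing_ofCoeffs hΩ w).eq_zero_of_norm0_eq_zero hb hn]
  rfl

theorem errorOperator_ofCoeffs (B : Matrix T.nodes T.nodes ℂ) (N : ℕ) (x : T.nodes → ℂ) :
    T.errorOperator B N (T.ofCoeffs x) =
      T.ofCoeffs (((T.inexactInverse B N - T.stiffness⁻¹) * T.stiffness) *ᵥ x) := by
  rw [errorOperator, coeffs_ofCoeffs]

theorem isHermitian_inexactInverse_sub_inv {B : Matrix T.nodes T.nodes ℂ} (hB : B.IsHermitian)
    (N : ℕ) : (T.inexactInverse B N - T.stiffness⁻¹).IsHermitian :=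
  (isHermitian_cyclesMatrix T.isHermitian_stiffness hB N).sub T.isHermitian_stiffness.inv

/-- `x* K P M x = (u, E_N u)`, where `P = K̃^{-N} - K⁻¹` and `u` has the coefficients `x`. -/
theorem norm_star_dotProduct_stiffness_mul_le (hΩ : IsOpen Ω) (hb : Bornology.IsBounded Ω)
    {B : Matrix T.nodes T.nodes ℂ} (hB : B.IsHermitian) {N : ℕ} {q : ℝ}
    (h0 : ∀ u ∈ T.feSpace, norm0 Ω (T.errorOperator B N u) ≤ q * norm0 Ω u)
    (x : T.nodes → ℂ) :
    ‖star x ⬝ᵥ (T.stiffness * (T.inexactInverse B N - T.stiffness⁻¹) * T.mass) *ᵥ x‖ ≤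
      q * norm0 Ω (T.ofCoeffs x) ^ 2 := by
  have hP := T.isHermitian_inexactInverse_sub_inv hB N
  have hE := h0 _ (T.ofCoeffs_mem_feSpace hΩ x)
  rw [errorOperator_ofCoeffs] at hE
  generalize T.inexactInverse B N - T.stiffness⁻¹ = P at *
  have heq : star x ⬝ᵥ (T.stiffness * P * T.mass) *ᵥ x =
      l2Inner Ω (T.ofCoeffs x) (T.ofCoeffs ((P * T.stiffness) *ᵥ x)) := by
    rw [T.l2Inner_ofCoeffs hΩ hb, Matrix.star_mulVec, Matrix.conjTranspose_mul, hP.eq,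
      T.isHermitian_stiffness.eq, ← Matrix.dotProduct_mulVec, Matrix.mulVec_mulVec]
  rw [heq]
  refine ((T.isLipschitzVanishing_ofCoeffs hΩ x).norm_l2Inner_le hb
    (T.isLipschitzVanishing_ofCoeffs hΩ _)).trans ?_
  calc _ ≤ norm0 Ω (T.ofCoeffs x) * (q * norm0 Ω (T.ofCoeffs x)) :=
        mul_le_mul_of_nonneg_left hE (Real.sqrt_nonneg _)
    _ = _ := by ring

/-- `x* M P M x = (∇ E_N w, ∇w)`, where `P = K̃^{-N} - K⁻¹` and `w` is the finite element solution
of the Poisson problem whose right-hand side has the coefficients `x`. -/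
theorem norm_star_dotProduct_mass_mul_le (hΩ : IsOpen Ω) {R : ℝ} (hR0 : 0 ≤ R)
    (hR : Ω ⊆ Metric.closedBall 0 R) (k : Fin d)
    {B : Matrix T.nodes T.nodes ℂ} {N : ℕ} {q : ℝ} (hq : 0 ≤ q)
    (h1 : ∀ u ∈ T.feSpace, norm1 Ω (T.errorOperator B N u) ≤ q * norm1 Ω u)
    (x : T.nodes → ℂ) :
    ‖star x ⬝ᵥ (T.mass * (T.inexactInverse B N - T.stiffness⁻¹) * T.mass) *ᵥ x‖ ≤
      q * (((2 * R) ^ 2 + (2 * R) ^ 4) * norm0 Ω (T.ofCoeffs x) ^ 2) := by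
  have hb : Bornology.IsBounded Ω := Metric.isBounded_closedBall.subset hR
  obtain ⟨w, hKw⟩ : ∃ w, T.stiffness *ᵥ w = T.mass *ᵥ x :=
    ⟨T.stiffness⁻¹ *ᵥ (T.mass *ᵥ x), by
      rw [Matrix.mulVec_mulVec, Matrix.mul_nonsing_inv _ (T.isUnit_stiffness_det hΩ hb k),
        Matrix.one_mulVec]⟩
  have hE := h1 _ (T.ofCoeffs_mem_feSpace hΩ w)
  rw [errorOperator_ofCoeffs] at hE
  generalize T.inexactInverse B N - T.stiffness⁻¹ = P at *
  have heq : star x ⬝ᵥ (T.mass * P * T.mass) *ᵥ x =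
      gradInner Ω (T.ofCoeffs ((P * T.stiffness) *ᵥ w)) (T.ofCoeffs w) := by
    have hadj : star x ᵥ* T.mass = star w ᵥ* T.stiffness := by
      have h := congrArg star hKw
      rw [Matrix.star_mulVec, Matrix.star_mulVec, T.isHermitian_stiffness.eq,
        T.isHermitian_mass.eq] at h
      exact h.symm
    rw [T.gradInner_ofCoeffs hΩ hb, ← Matrix.mulVec_mulVec, ← Matrix.mulVec_mulVec,
      Matrix.dotProduct_mulVec (star x), hadj, ← Matrix.dotProduct_mulVec, ← hKw,
      Matrix.mulVec_mulVec w P]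
  rw [heq]
  refine ((T.isLipschitzVanishing_ofCoeffs hΩ _).norm_gradInner_le hb
    (T.isLipschitzVanishing_ofCoeffs hΩ w)).trans ?_
  calc _ ≤ q * norm1 Ω (T.ofCoeffs w) * norm1 Ω (T.ofCoeffs w) :=
        mul_le_mul_of_nonneg_right hE (Real.sqrt_nonneg _)
    _ = q * norm1 Ω (T.ofCoeffs w) ^ 2 := by ring
    _ ≤ _ := mul_le_mul_of_nonneg_left
        (T.norm1_sq_le_of_stiffness_mulVec_eq hΩ hR0 hR k hKw) hq

end Triangulation

end Helmholtz

theorem theorem5p1 (d : ℕ) (hd : d = 2 ∨ d = 3) (Ω : Set (Helmholtz.E d))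
    (hΩ_open : IsOpen Ω) (hΩ_conn : IsConnected Ω) (hΩ_bdd : Bornology.IsBounded Ω)
    (ρ : ℝ) (hρ : 0 < ρ) (C₀ : ℝ) (hC₀ : 0 < C₀) :
    ∃ C : ℝ, 0 < C ∧
      ∀ (T : Helmholtz.Triangulation Ω), T.IsQuasiUniform ρ →
      ∀ (κ σ : ℝ), 0 < σ →
      ∀ (γ₀ γ₁ : ℝ), 0 ≤ γ₀ → γ₀ < 1 → 0 ≤ γ₁ → γ₁ < 1 →
      ∀ (B : Matrix T.nodes T.nodes ℂ), B.IsHermitian →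
      ∀ (N : ℕ),
        (∀ u ∈ T.feSpace, Helmholtz.norm1 Ω (T.errorOperator B N u)
          ≤ C₀ * γ₁ ^ N * Helmholtz.norm1 Ω u) →
        (∀ u ∈ T.feSpace, Helmholtz.norm0 Ω (T.errorOperator B N u)
          ≤ C₀ * γ₀ ^ N * Helmholtz.norm0 Ω u) →
        Complex.re '' Helmholtz.fieldOfValues
            (T.systemMatrix κ σ * (T.inexactInverse B N - T.stiffness⁻¹) * T.mass)
          ⊆ Set.Icc (-(C * T.meshSize ^ d * (γ₀ ^ N + κ ^ 2 * γ₁ ^ N)))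
              (C * T.meshSize ^ d * (γ₀ ^ N + κ ^ 2 * γ₁ ^ N)) ∧
        Complex.im '' Helmholtz.fieldOfValues
            (T.systemMatrix κ σ * (T.inexactInverse B N - T.stiffness⁻¹) * T.mass)
          ⊆ Set.Icc (-(C * T.meshSize ^ d * (γ₀ ^ N + σ * γ₁ ^ N)))
              (C * T.meshSize ^ d * (γ₀ ^ N + σ * γ₁ ^ N)) := by
  have k : Fin d := ⟨0, by omega⟩
  obtain ⟨R', hR'⟩ := hΩ_bdd.subset_closedBall 0
  obtain ⟨R, hR0, hR⟩ : ∃ R : ℝ, 0 ≤ R ∧ Ω ⊆ Metric.closedBall 0 R :=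
    ⟨max R' 0, le_max_right _ _,
      hR'.trans (Metric.closedBall_subset_closedBall (le_max_left _ _))⟩
  set V : ℝ := volume.real (Metric.ball (0 : Helmholtz.E d) 1) with hV
  have hVpos : 0 < V :=
    ENNReal.toReal_pos (Metric.measure_ball_pos volume _ one_pos).ne' measure_ball_lt_top.ne
  set D : ℝ := (2 * R) ^ 2 + (2 * R) ^ 4 with hD
  have hD0 : 0 ≤ D := by positivity
  refine ⟨C₀ * V * (1 + D), by positivity, ?_⟩
  intro T _ κ σ hσ γ₀ γ₁ hγ₀ _ hγ₁ _ B hB N h1 h0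
  have hg0 : 0 ≤ γ₀ ^ N := pow_nonneg hγ₀ N
  have hg1 : 0 ≤ γ₁ ^ N := pow_nonneg hγ₁ N
  have hh : 0 ≤ T.meshSize ^ d := pow_nonneg T.meshSize_nonneg d
  -- Since `x* M P M x` is real, the real part of its coefficient `-κ ^ 2 + i σ` enters only the
  -- real part, and the imaginary part only the imaginary part.
  have key : ∀ x : T.nodes → ℂ, x ≠ 0 → ∃ (s₁ : ℂ) (s₂ : ℝ),
      (star x ⬝ᵥ (T.systemMatrix κ σ * (T.inexactInverse B N - T.stiffness⁻¹) * T.mass) *ᵥ x) /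
        (star x ⬝ᵥ x) = s₁ + ((-κ ^ 2 : ℝ) + Complex.I * (σ : ℝ)) * (s₂ : ℂ) ∧
      ‖s₁‖ ≤ C₀ * V * (1 + D) * T.meshSize ^ d * γ₀ ^ N ∧
      |s₂| ≤ C₀ * V * (1 + D) * T.meshSize ^ d * γ₁ ^ N := by
    intro x hx
    have hB1 := T.norm_star_dotProduct_stiffness_mul_le hΩ_open hΩ_bdd hB h0 x
    have hB2 := T.norm_star_dotProduct_mass_mul_le hΩ_open hR0 hR k
      (by positivity : 0 ≤ C₀ * γ₁ ^ N) h1 x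
    have hP := T.isHermitian_inexactInverse_sub_inv hB N
    have hu := T.norm0_ofCoeffs_sq_le hΩ_open x
    rw [← hV] at hu
    rw [← hD] at hB2
    have hMPM : (T.mass * (T.inexactInverse B N - T.stiffness⁻¹) * T.mass).IsHermitian := by
      have := Matrix.isHermitian_conjTranspose_mul_mul T.mass hP
      rwa [T.isHermitian_mass.eq] at this
    rw [T.systemMatrix_eq, add_mul, add_mul, Matrix.smul_mul, Matrix.smul_mul, Matrix.add_mulVec,
      Matrix.smul_mulVec, dotProduct_add, dotProduct_smul]
    generalize T.inexactInverse B N - T.stiffness⁻¹ = P at *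
    have hreal : star x ⬝ᵥ (T.mass * P * T.mass) *ᵥ x =
        ((star x ⬝ᵥ (T.mass * P * T.mass) *ᵥ x).re : ℂ) :=
      (Complex.ext rfl (by simpa using hMPM.im_star_dotProduct_mulVec_self x))
    generalize (star x ⬝ᵥ (T.mass * P * T.mass) *ᵥ x).re = r at hreal
    rw [hreal, Complex.norm_real, Real.norm_eq_abs] at hB2
    rw [hreal]
    set Q : ℝ := ∑ v, ‖x v‖ ^ 2 with hQ
    have hxx : star x ⬝ᵥ x = (Q : ℂ) := by
      simp [dotProduct, hQ, Complex.conj_mul']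
    have hQpos : 0 < Q := by
      obtain ⟨v, hv⟩ := Function.ne_iff.1 hx
      exact Finset.sum_pos' (fun _ _ => by positivity)
        ⟨v, Finset.mem_univ v, by have : 0 < ‖x v‖ := norm_pos_iff.2 hv; positivity⟩
    have hU0 : 0 ≤ Helmholtz.norm0 Ω (T.ofCoeffs x) ^ 2 := sq_nonneg _
    generalize Helmholtz.norm0 Ω (T.ofCoeffs x) ^ 2 = U at *
    refine ⟨(star x ⬝ᵥ (T.stiffness * P * T.mass) *ᵥ x) / Q, r / Q, ?_, ?_, ?_⟩
    · rw [hxx, smul_eq_mul]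
      push_cast
      ring
    · rw [norm_div, Complex.norm_real, Real.norm_of_nonneg hQpos.le, div_le_iff₀ hQpos]
      calc _ ≤ C₀ * γ₀ ^ N * U := hB1
        _ ≤ C₀ * γ₀ ^ N * (V * T.meshSize ^ d * Q) := by gcongr
        _ ≤ C₀ * γ₀ ^ N * (V * T.meshSize ^ d * Q) * (1 + D) :=
            le_mul_of_one_le_right (by positivity) (by linarith)
        _ = _ := by ring
    · rw [abs_div, abs_of_pos hQpos, div_le_iff₀ hQpos]
      calc _ ≤ C₀ * γ₁ ^ N * (D * U) := hB2
        _ ≤ C₀ * γ₁ ^ N * ((1 + D) * (V * T.meshSize ^ d * Q)) := by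
            have : D ≤ 1 + D := by linarith
            gcongr
        _ = _ := by ring
  constructor
  · rintro _ ⟨_, ⟨x, hx, rfl⟩, rfl⟩
    obtain ⟨s₁, s₂, heq, hs₁, hs₂⟩ := key x hx
    rw [heq, Set.mem_Icc, ← abs_le]
    have hre : (s₁ + ((-κ ^ 2 : ℝ) + Complex.I * (σ : ℝ)) * (s₂ : ℂ)).re =
        s₁.re + -κ ^ 2 * s₂ := by
      simp [pow_two]
    rw [hre]
    calc |s₁.re + -κ ^ 2 * s₂| ≤ |s₁.re| + |-κ ^ 2 * s₂| := abs_add_le _ _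
      _ ≤ ‖s₁‖ + κ ^ 2 * |s₂| := by
          rw [abs_mul, abs_neg, abs_sq]
          gcongr
          exact Complex.abs_re_le_norm s₁
      _ ≤ _ := add_le_add hs₁ (mul_le_mul_of_nonneg_left hs₂ (sq_nonneg κ))
      _ = _ := by ring
  · rintro _ ⟨_, ⟨x, hx, rfl⟩, rfl⟩
    obtain ⟨s₁, s₂, heq, hs₁, hs₂⟩ := key x hx
    rw [heq, Set.mem_Icc, ← abs_le]
    have him : (s₁ + ((-κ ^ 2 : ℝ) + Complex.I * (σ : ℝ)) * (s₂ : ℂ)).im =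
        s₁.im + σ * s₂ := by
      simp [pow_two]
    rw [him]
    calc |s₁.im + σ * s₂| ≤ |s₁.im| + |σ * s₂| := abs_add_le _ _
      _ ≤ ‖s₁‖ + σ * |s₂| := by
          rw [abs_mul, abs_of_pos hσ]
          gcongr
          exact Complex.abs_im_le_norm s₁
      _ ≤ _ := add_le_add hs₁ (mul_le_mul_of_nonneg_left hs₂ hσ.le)
      _ = _ := by ring
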